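/- Let $\mathbb{S}^2\subset\mathbb{R}^3$ be the unit sphere with its standard metric, complex structure $J_xv=x\times v$ and area form $\omega_0(v,w)=\langle x\times v,w\rangle$, $v,w\in T_x\mathbb{S}^2$. Let $\Sigma$ be a smooth surface and let $\Phi=(\phi,\psi):\Sigma\to\mathbb{S}^2\times\mathbb{S}^2$ be a (smooth) Lagrangian immersion, i.e. a smooth immersion with $\phi^*\omega_0+\psi^*\omega_0=0$. Let $g=\phi^*\langle,\rangle+\psi^*\langle,\rangle$ be the induced metric and let the square of the associated Jacobian be the function $$C^2(p)=\langle J\,d\phi_p(e_1),d\phi_p(e_2)\rangle^2,\qquad p\in\Sigma,$$ where $\{e_1,e_2\}$ is any orthonormal basis of $(T_p\Sigma,g)$ (the value does not depend on the basis). Call two subsets of $\mathbb{S}^2\times\mathbb{S}^2$ congruent if one is mapped onto the other by an element of the isometry group of $\mathbb{S}^2\times\mathbb{S}^2$, which consists of the maps $(x,y)\mapsto(Ax,By)$ and $(x,y)\mapsto(Ay,Bx)$ with $A,B\in\mathrm{O}(3)$. Then: 1. $C^2\le 1/4$ on $\Sigma$. 2. If $\Phi(\Sigma)$ is congruent to an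 open subset of the surface $\mathbf{M}_0=\{(x,-x) : x\in\mathbb{S}^2\}$, then $C^2\equiv 1/4$. Conversely, if $\Sigma$ is connected and $C^2\equiv 1/4$, then $\Phi(\Sigma)$ is congruent to an open subset of $\mathbf{M}_0$. Moreover, $\mathbf{M}_0$ is a Lagrangian surface: $x\mapsto(x,-x)$ is a Lagrangian immersion of $\mathbb{S}^2$ into $\mathbb{S}^2\times\mathbb{S}^2$. -/

import Mathlib

open scoped Manifold ContDiff Matrix

noncomputable section

/-- Euclidean three-space. -/
abbrev R3 : Type := EuclideanSpace ℝ (Fin 3)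

/-- The unit sphere of Euclidean three-space. -/
abbrev S2 : Type := Metric.sphere (0 : R3) 1

/-- The vectorial product of Euclidean three-space. For `x` in the sphere and `v` tangent at `x`,
`J_x v = x × v` is the complex structure of the sphere. -/
def cross3 (x v : R3) : R3 := WithLp.toLp 2 (WithLp.ofLp x ⨯₃ WithLp.ofLp v)

/-- The Kähler (area) form of the sphere, `ω₀ (v, w) = ⟪x × v, w⟫` for `v`, `w` tangent at `x`. -/
def areaForm (x : S2) (v w : R3) : ℝ := inner ℝ (cross3 x v) w

section Surface

variable {M : Type*} [TopologicalSpace M] [ChartedSpace (EuclideanSpace ℝ (Fin 2)) M]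

/-- The differential at `p` of the first component `φ` of `Φ = (φ, ψ)`, where tangent vectors of
the sphere are regarded as vectors of Euclidean three-space. -/
def dFst (Φ : M → S2 × S2) (p : M) : TangentSpace (𝓡 2) p →L[ℝ] R3 :=
  mvfderiv (𝓡 2) (fun q => ((Φ q).1 : R3)) p

/-- The differential at `p` of the second component `ψ` of `Φ = (φ, ψ)`. -/
def dSnd (Φ : M → S2 × S2) (p : M) : TangentSpace (𝓡 2) p →L[ℝ] R3 :=
  mvfderiv (𝓡 2) (fun q => ((Φ q).2 : R3)) p

/-- The pull-back `Φ^* ⟨,⟩ = φ^* ⟨,⟩ + ψ^* ⟨,⟩` of the product metric at `p`. -/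
def inducedMetric (Φ : M → S2 × S2) (p : M) (v w : TangentSpace (𝓡 2) p) : ℝ :=
  inner ℝ (dFst Φ p v) (dFst Φ p w) + inner ℝ (dSnd Φ p v) (dSnd Φ p w)

/-- `Φ` is a smooth immersion. -/
def IsSmoothImmersion (Φ : M → S2 × S2) : Prop :=
  ContMDiff (𝓡 2) ((𝓡 2).prod (𝓡 2)) ∞ Φ ∧
    ∀ p : M, Function.Injective (mfderiv (𝓡 2) ((𝓡 2).prod (𝓡 2)) Φ p)

/-- `Φ = (φ, ψ)` is a Lagrangian immersion: a smooth immersion with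
`φ^* ω₀ + ψ^* ω₀ = 0`. -/
def IsLagrangianImmersion (Φ : M → S2 × S2) : Prop :=
  IsSmoothImmersion Φ ∧
    ∀ (p : M) (v w : TangentSpace (𝓡 2) p),
      areaForm (Φ p).1 (dFst Φ p v) (dFst Φ p w) +
        areaForm (Φ p).2 (dSnd Φ p v) (dSnd Φ p w) = 0

/-- `e` is an orthonormal basis of the tangent plane at `p` for the induced metric. -/
def IsOrthonormalFrame (Φ : M → S2 × S2) (p : M) (e : Fin 2 → TangentSpace (𝓡 2) p) : Prop :=
  ∀ i j, inducedMetric Φ p (e i) (e j) = if i = j then 1 else 0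

open Classical in
/-- The square of the associated Jacobian, `C² (p) = ⟨J dφ (e₁), dφ (e₂)⟩²` for an orthonormal
basis `e₁, e₂` of the tangent plane. An orthonormal basis exists and the value does not depend on
it: see `exists_isOrthonormalFrame` and `jacobianSq_eq` below. -/
def jacobianSq (Φ : M → S2 × S2) (p : M) : ℝ :=
  if h : ∃ e, IsOrthonormalFrame Φ p e then
    areaForm (Φ p).1 (dFst Φ p (h.choose 0)) (dFst Φ p (h.choose 1)) ^ 2
  else 0

theorem areaForm_add_smul (x : S2) (v w : R3) (a b c d : ℝ) :
    areaForm x (a • v + b • w) (c • v + d • w) = (a * d - b * c) * areaForm x v w := by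
  simp only [areaForm, cross3, PiLp.inner_apply, Fin.sum_univ_three, cross_apply]
  simp
  ring

theorem inducedMetric_comm (Φ : M → S2 × S2) (p : M) (v w : TangentSpace (𝓡 2) p) :
    inducedMetric Φ p v w = inducedMetric Φ p w v := by
  simp only [inducedMetric, real_inner_comm]

theorem inducedMetric_add_smul (Φ : M → S2 × S2) (p : M) (u v w : TangentSpace (𝓡 2) p)
    (a b : ℝ) : inducedMetric Φ p (a • u + b • v) w =
      a * inducedMetric Φ p u w + b * inducedMetric Φ p v w := by
  simp only [inducedMetric, map_add, map_smul, inner_add_left, real_inner_smul_left]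
  ring

/-- The value of `jacobianSq` can be computed in any orthonormal basis. -/
theorem jacobianSq_eq (Φ : M → S2 × S2) (p : M) (e : Fin 2 → TangentSpace (𝓡 2) p)
    (he : IsOrthonormalFrame Φ p e) :
    jacobianSq Φ p = areaForm (Φ p).1 (dFst Φ p (e 0)) (dFst Φ p (e 1)) ^ 2 := by
  have h : ∃ e, IsOrthonormalFrame Φ p e := ⟨e, he⟩
  rw [jacobianSq, dif_pos h]
  have hf := h.choose_spec
  set f := h.choose
  have hz : ∀ w, inducedMetric Φ p 0 w = 0 := by intro w; simp [inducedMetric]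
  have hli : LinearIndependent ℝ e := by
    rw [linearIndependent_fin2]
    refine ⟨fun h0 => ?_, fun a ha => ?_⟩
    · have := he 1 1
      rw [h0, hz] at this
      simp at this
    · have h1 := he 0 0
      have h2 := he 1 0
      have h3 := inducedMetric_add_smul Φ p (e 1) 0 (e 0) a 0
      rw [smul_zero, add_zero, ha, h1, h2] at h3
      simp at h3
  have hspan : ∀ x : TangentSpace (𝓡 2) p, ∃ a b : ℝ, x = a • e 0 + b • e 1 := by
    intro x
    have hfr : Module.finrank ℝ (TangentSpace (𝓡 2) p) = 2 :=
      finrank_euclideanSpace_fin (𝕜 := ℝ) (n := 2)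
    let B := basisOfLinearIndependentOfCardEqFinrank hli (by simp [hfr])
    refine ⟨B.repr x 0, B.repr x 1, ?_⟩
    have := B.sum_repr x
    simpa [B, Fin.sum_univ_two] using this.symm
  obtain ⟨a, b, hab⟩ := hspan (f 0)
  obtain ⟨c, d, hcd⟩ := hspan (f 1)
  have e00 := he 0 0
  have e01 := he 0 1
  have e10 := he 1 0
  have e11 := he 1 1
  have f00 := hf 0 0
  have f01 := hf 0 1
  have f11 := hf 1 1
  have key : ∀ a b c d : ℝ,
      inducedMetric Φ p (a • e 0 + b • e 1) (c • e 0 + d • e 1) = a * c + b * d := by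
    intro a b c d
    rw [inducedMetric_add_smul, inducedMetric_comm Φ p (e 0), inducedMetric_comm Φ p (e 1),
      inducedMetric_add_smul, inducedMetric_add_smul, e00, e01, e10, e11]
    simp
  rw [hab, key] at f00
  rw [hab, hcd, key] at f01
  rw [hcd, key] at f11
  simp only [if_true, zero_ne_one, if_false] at f00 f01 f11
  have hdet : (a * d - b * c) ^ 2 = 1 := by
    have : (a * d - b * c) ^ 2 = (a * a + b * b) * (c * c + d * d) - (a * c + b * d) ^ 2 := by
      ring
    rw [this, f00, f01, f11]
    norm_num
  rw [hab, hcd, map_add, map_add, map_smul, map_smul, map_smul, map_smul, areaForm_add_smul,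
    mul_pow, hdet, one_mul]

/-- The differential of the inclusion of the sphere is injective. -/
theorem injective_mvfderiv_coe (x : S2) :
    Function.Injective (mvfderiv (𝓡 2) (fun y : S2 => (y : R3)) x) :=
  haveI : Fact (Module.finrank ℝ R3 = 2 + 1) := ⟨finrank_euclideanSpace_fin⟩
  injective_mvfderiv_subtypeVal_sphere x

theorem mdifferentiableAt_coe (x : S2) :
    MDifferentiableAt (𝓡 2) 𝓘(ℝ, R3) (fun y : S2 => (y : R3)) x :=
  haveI : Fact (Module.finrank ℝ R3 = 2 + 1) := ⟨finrank_euclideanSpace_fin⟩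
  (contMDiff_coe_sphere (m := 1) x).mdifferentiableAt one_ne_zero

theorem mvfderiv_coe_comp (f : M → S2) (p : M) (hf : MDifferentiableAt (𝓡 2) (𝓡 2) f p)
    (v : TangentSpace (𝓡 2) p) : mvfderiv (𝓡 2) (fun q => (f q : R3)) p v =
      mvfderiv (𝓡 2) (fun y : S2 => (y : R3)) (f p) (mfderiv (𝓡 2) (𝓡 2) f p v) := by
  have h := mfderiv_comp (I := 𝓡 2) (I' := 𝓡 2) (I'' := 𝓘(ℝ, R3)) (g := fun y : S2 => (y : R3))
    (f := f) p (mdifferentiableAt_coe (f p)) hf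
  change mfderiv (𝓡 2) 𝓘(ℝ, R3) ((fun y : S2 => (y : R3)) ∘ f) p v = _
  rw [h]
  rfl

/-- The induced metric of an immersion is positive definite. -/
theorem inducedMetric_pos (Φ : M → S2 × S2) (hΦ : IsSmoothImmersion Φ)
    (p : M) (v : TangentSpace (𝓡 2) p) (hv : v ≠ 0) : 0 < inducedMetric Φ p v v := by
  have hd : MDifferentiableAt (𝓡 2) ((𝓡 2).prod (𝓡 2)) Φ p :=
    (hΦ.1 p).mdifferentiableAt (by simp)
  have h1 : MDifferentiableAt (𝓡 2) (𝓡 2) (fun q => (Φ q).1) p := mdifferentiableAt_fst.comp p hd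
  have h2 : MDifferentiableAt (𝓡 2) (𝓡 2) (fun q => (Φ q).2) p := mdifferentiableAt_snd.comp p hd
  have e1 := mvfderiv_coe_comp (fun q => (Φ q).1) p h1 v
  have e2 := mvfderiv_coe_comp (fun q => (Φ q).2) p h2 v
  by_contra hcon
  have hn : ‖dFst Φ p v‖ ^ 2 + ‖dSnd Φ p v‖ ^ 2 ≤ 0 := by
    simpa [inducedMetric] using hcon
  have n1 : dFst Φ p v = 0 := by
    rw [← norm_eq_zero]; nlinarith [sq_nonneg ‖dFst Φ p v‖, sq_nonneg ‖dSnd Φ p v‖]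
  have n2 : dSnd Φ p v = 0 := by
    rw [← norm_eq_zero]; nlinarith [sq_nonneg ‖dFst Φ p v‖, sq_nonneg ‖dSnd Φ p v‖]
  have z1 : mfderiv (𝓡 2) (𝓡 2) (fun q => (Φ q).1) p v = 0 :=
    injective_mvfderiv_coe (Φ p).1 ((e1.symm.trans n1).trans (map_zero _).symm)
  have z2 : mfderiv (𝓡 2) (𝓡 2) (fun q => (Φ q).2) p v = 0 :=
    injective_mvfderiv_coe (Φ p).2 ((e2.symm.trans n2).trans (map_zero _).symm)
  apply hv
  apply hΦ.2 p
  rw [map_zero]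
  have hm := (h1.hasMFDerivAt.prodMk h2.hasMFDerivAt).mfderiv
  have : mfderiv (𝓡 2) ((𝓡 2).prod (𝓡 2)) Φ p v =
      (mfderiv (𝓡 2) (𝓡 2) (fun q => (Φ q).1) p v,
        mfderiv (𝓡 2) (𝓡 2) (fun q => (Φ q).2) p v) := congrArg (fun L => L v) hm
  rw [this, z1, z2]
  rfl

/-- The tangent planes of an immersed surface have orthonormal bases. -/
theorem exists_isOrthonormalFrame (Φ : M → S2 × S2)
    (hΦ : IsSmoothImmersion Φ) (p : M) : ∃ e, IsOrthonormalFrame Φ p e := by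
  let b : Fin 2 → TangentSpace (𝓡 2) p := fun i =>
    (EuclideanSpace.basisFun (Fin 2) ℝ i : EuclideanSpace ℝ (Fin 2))
  have hb : LinearIndependent ℝ b :=
    (EuclideanSpace.basisFun (Fin 2) ℝ).toBasis.linearIndependent.comp id Function.injective_id
  rw [linearIndependent_fin2] at hb
  obtain ⟨hu, hind⟩ := hb
  set u := b 1
  set x := b 0
  have hg : 0 < inducedMetric Φ p u u := inducedMetric_pos Φ hΦ p u hu
  set g := inducedMetric Φ p u u with hgdef
  set t := inducedMetric Φ p x u / g with ht
  set w := (1 : ℝ) • x + (-t) • u with hw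
  have hw0 : w ≠ 0 := by
    intro h0
    apply hind t
    have : x = t • u + w := by rw [hw]; module
    rw [this, h0, add_zero]
  have hwu : inducedMetric Φ p w u = 0 := by
    rw [hw, inducedMetric_add_smul, ← hgdef, ht]
    field_simp
    ring
  have hk : 0 < inducedMetric Φ p w w := inducedMetric_pos Φ hΦ p w hw0
  set k := inducedMetric Φ p w w with hkdef
  have sm : ∀ (a c : ℝ) (y z : TangentSpace (𝓡 2) p),
      inducedMetric Φ p (a • y) (c • z) = a * c * inducedMetric Φ p y z := by
    intro a c y z
    simp only [inducedMetric, map_smul, real_inner_smul_left, real_inner_smul_right]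
    ring
  refine ⟨![(√g)⁻¹ • u, (√k)⁻¹ • w], ?_⟩
  have hgs : (√g)⁻¹ * (√g)⁻¹ * g = 1 := by
    rw [← mul_inv, Real.mul_self_sqrt hg.le, inv_mul_cancel₀ hg.ne']
  have hks : (√k)⁻¹ * (√k)⁻¹ * k = 1 := by
    rw [← mul_inv, Real.mul_self_sqrt hk.le, inv_mul_cancel₀ hk.ne']
  have huw : inducedMetric Φ p u w = 0 := by rw [inducedMetric_comm, hwu]
  intro i j
  fin_cases i <;> fin_cases j
  · simpa [sm, ← hgdef] using hgs
  · simp [sm, huw]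
  · simp [sm, hwu]
  · simpa [sm, ← hkdef] using hks

end Surface

/-- `T` belongs to the group of isometries of the product of two spheres, which consists of the maps `(x, y) ↦ (A x, B y)` and
`(x, y) ↦ (A y, B x)` with `A`, `B` in the orthogonal group of Euclidean three-space. -/
def IsIsometryOfProduct (T : S2 × S2 → S2 × S2) : Prop :=
  ∃ A B : R3 ≃ₗᵢ[ℝ] R3,
    (∀ q, ((T q).1 : R3) = A q.1 ∧ ((T q).2 : R3) = B q.2) ∨
    (∀ q, ((T q).1 : R3) = A q.2 ∧ ((T q).2 : R3) = B q.1)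

/-- Two subsets of the product of two spheres are congruent. -/
def AreCongruent (X Y : Set (S2 × S2)) : Prop :=
  ∃ T : S2 × S2 → S2 × S2, IsIsometryOfProduct T ∧ X = T '' Y

/-- The surface `M₀ = {(x, -x) | x ∈ S²}`. -/
def antidiagonal : Set (S2 × S2) := {q | ∃ x : S2, q = (x, -x)}

/-- `V` is an open subset of the surface `M₀`. -/
def IsOpenSubsetOfAntidiagonal (V : Set (S2 × S2)) : Prop :=
  ∃ U : Set (S2 × S2), IsOpen U ∧ V = U ∩ antidiagonal

end

/-!
Fix an orthonormal frame `e₁, e₂` of the surface at a point. The Gram matrices of `dφ` and `dψ` in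
this frame add up to the identity, and their determinants are the squares of the Jacobians of `φ`
and `ψ`, which agree because the surface is Lagrangian. Hence the first Gram matrix has trace one
and determinant `C² ≤ 1 / 4`, with equality exactly when it is half of the identity, that is, when
`φ` and `ψ` induce the same metric (`jacobianSq_eq_quarter_iff`).

If the image is congruent to a part of `M₀` then `ψ = C ∘ φ` for a linear isometry `C`, so `φ` and
`ψ` do induce the same metric. Conversely, if they do, both are local diffeomorphisms into the
sphere and `ψ ∘ φ⁻¹` is locally an isometry of the sphere; such a map is the restriction of a linear
isometry `A` (`exists_linearIsometryEquiv_eq`). The image is then the graph of `A` over the open set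
`φ (M)`, and `(x, y) ↦ (x, -A y)` maps a part of `M₀` onto it.

The rigidity statement is proved by passing to the cones `(t, y) ↦ t • f y` over the two local
parametrizations. They are local diffeomorphisms into the Euclidean space with the same induced
metric, and by Koszul's formula the linear isometry which carries the differential of one to that of
the other has zero derivative (`hasFDerivAt_transition_zero`). The local isometries so obtained fit
together on a connected surface, because each of them is determined by any piece of it.
-/

open Filter Topology

/-! ### Maps into a Euclidean space with the same induced metric -/

section Rigidity

variable {X V : Type*} [NormedAddCommGroup X] [NormedSpace ℝ X]
  [NormedAddCommGroup V] [InnerProductSpace ℝ V]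

/-- The fundamental lemma of Riemannian geometry for maps into a Euclidean space: the tangential part
of the second derivative is determined by the induced metric, through Koszul's formula. -/
theorem inner_snd_fderiv_eq {F H : X → V} {x : X}
    (hF : ContDiffAt ℝ 2 F x) (hH : ContDiffAt ℝ 2 H x)
    (hmet : ∀ᶠ y in 𝓝 x, ∀ u v, inner ℝ (fderiv ℝ F y u) (fderiv ℝ F y v) =
      inner ℝ (fderiv ℝ H y u) (fderiv ℝ H y v)) (u v w : X) :
    inner ℝ (fderiv ℝ (fderiv ℝ F) x u v) (fderiv ℝ F x w) =
      inner ℝ (fderiv ℝ (fderiv ℝ H) x u v) (fderiv ℝ H x w) := by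
  have d1 : ∀ {G : X → V}, ContDiffAt ℝ 2 G x → ∀ v, HasFDerivAt (fun y => fderiv ℝ G y v)
      ((ContinuousLinearMap.apply ℝ V v).comp (fderiv ℝ (fderiv ℝ G) x)) x := fun hG v =>
    (ContinuousLinearMap.apply ℝ V v).hasFDerivAt.comp x
      (((hG.fderiv_right (m := 1) (by norm_num)).differentiableAt one_ne_zero).hasFDerivAt)
  have d2 : ∀ {G : X → V}, ContDiffAt ℝ 2 G x → ∀ a b c,
      fderiv ℝ (fun y => (inner ℝ (fderiv ℝ G y b) (fderiv ℝ G y c) : ℝ)) x a =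
      inner ℝ (fderiv ℝ G x b) (fderiv ℝ (fderiv ℝ G) x a c) +
        inner ℝ (fderiv ℝ (fderiv ℝ G) x a b) (fderiv ℝ G x c) := fun hG a b c => by
    rw [((d1 hG b).inner ℝ (d1 hG c)).fderiv]
    simp
  have e : ∀ a b c, _ := fun a b c => by
    have h : (fun y => (inner ℝ (fderiv ℝ F y b) (fderiv ℝ F y c) : ℝ)) =ᶠ[𝓝 x]
        fun y => inner ℝ (fderiv ℝ H y b) (fderiv ℝ H y c) := hmet.mono fun y hy => hy b c
    have := congrArg (fun T : X →L[ℝ] ℝ => T a) h.fderiv_eq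
    simpa only [d2 hF, d2 hH] using this
  have sF := fun a b => (hF.isSymmSndFDerivAt (by simp)).eq a b
  have sH := fun a b => (hH.isSymmSndFDerivAt (by simp)).eq a b
  -- Koszul's combination of the three cyclic permutations
  have e1 := e u v w
  have e2 := e v u w
  have e3 := e w u v
  rw [sF w u, sH w u, sF w v, sH w v] at e3
  rw [sF v u, sH v u] at e2
  simp only [real_inner_comm (fderiv ℝ F x _) (fderiv ℝ (fderiv ℝ F) x _ _),
    real_inner_comm (fderiv ℝ H x _) (fderiv ℝ (fderiv ℝ H) x _ _)] at e1 e2 e3 ⊢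
  linarith

/-- If `F` and `H` induce the same metric and both are local diffeomorphisms, then `DH ∘ DF⁻¹` has
zero derivative. Indeed its value at a point is a linear isometry carrying `DF` to `DH`, hence, by
`inner_snd_fderiv_eq`, also `D²F` to `D²H`, and differentiating `(DH ∘ DF⁻¹) ∘ DF = DH` leaves
nothing for the derivative of `DH ∘ DF⁻¹`. -/
theorem hasFDerivAt_transition_zero [CompleteSpace X] {F H : X → V} {x : X}
    (hF : ContDiffAt ℝ 2 F x) (hH : ContDiffAt ℝ 2 H x)
    (hmet : ∀ᶠ y in 𝓝 x, ∀ u v, inner ℝ (fderiv ℝ F y u) (fderiv ℝ F y v) =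
      inner ℝ (fderiv ℝ H y u) (fderiv ℝ H y v))
    (iF : ∀ᶠ y in 𝓝 x, (fderiv ℝ F y).IsInvertible)
    (iH : Function.Surjective (fderiv ℝ H x)) :
    HasFDerivAt (𝕜 := ℝ) (fun y => (fderiv ℝ H y).comp (fderiv ℝ F y).inverse)
      (0 : X →L[ℝ] V →L[ℝ] V) x := by
  have dF : DifferentiableAt ℝ (fderiv ℝ F) x :=
    (hF.fderiv_right (m := 1) (by norm_num)).differentiableAt one_ne_zero
  have dH : DifferentiableAt ℝ (fderiv ℝ H) x :=
    (hH.fderiv_right (m := 1) (by norm_num)).differentiableAt one_ne_zero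
  have di : DifferentiableAt ℝ (fun y => (fderiv ℝ F y).inverse) x :=
    (((iF.self_of_nhds).contDiffAt_map_inverse (n := 1)).differentiableAt one_ne_zero).comp x dF
  set A : X → V →L[ℝ] V := fun y => (fderiv ℝ H y).comp (fderiv ℝ F y).inverse with hA
  have dA : DifferentiableAt ℝ A x := dH.clm_comp di
  have hAF : ∀ y, (fderiv ℝ F y).IsInvertible → ∀ u, A y (fderiv ℝ F y u) = fderiv ℝ H y u := by
    intro y hy u
    simp [hA, hy.inverse_apply_self]
  have hprod : (fun y => (A y).comp (fderiv ℝ F y)) =ᶠ[𝓝 x] fderiv ℝ H :=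
    iF.mono fun y hy => ContinuousLinearMap.ext (hAF y hy)
  have hder := (dA.hasFDerivAt.clm_comp dF.hasFDerivAt).unique
    (dH.hasFDerivAt.congr_of_eventuallyEq hprod)
  have iFx := iF.self_of_nhds
  have Aiso : ∀ a b, inner ℝ (A x a) (A x b) = (inner ℝ a b : ℝ) := by
    intro a b
    obtain ⟨a, rfl⟩ := iFx.surjective a
    obtain ⟨b, rfl⟩ := iFx.surjective b
    rw [hAF x iFx, hAF x iFx, hmet.self_of_nhds]
  have hsnd : ∀ u v, A x (fderiv ℝ (fderiv ℝ F) x u v) = fderiv ℝ (fderiv ℝ H) x u v := by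
    intro u v
    refine ext_inner_right ℝ fun w => ?_
    obtain ⟨w, rfl⟩ := iH w
    rw [← inner_snd_fderiv_eq hF hH hmet, ← hAF x iFx w, Aiso]
  have hzero : fderiv ℝ A x = 0 := by
    ext u a
    obtain ⟨v, rfl⟩ := iFx.surjective a
    have := congrArg (fun T => T u v) hder
    simpa [hsnd] using this
  simpa [hzero] using dA.hasFDerivAt

end Rigidity

/-! ### Rigidity of immersions into the unit sphere, by means of cones -/

section Cone

variable {E V : Type*} [NormedAddCommGroup E] [NormedSpace ℝ E]
  [NormedAddCommGroup V] [InnerProductSpace ℝ V]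

/-- The cone `(t, y) ↦ t • f y` over a parametrization `f`. For `f` with values in the unit sphere
it expresses a neighbourhood of the image in polar coordinates. -/
def cone (f : E → V) (q : ℝ × E) : V := q.1 • f q.2

theorem contDiffAt_cone {f : E → V} {n : ℕ∞ω} {q : ℝ × E} (hf : ContDiffAt ℝ n f q.2) :
    ContDiffAt ℝ n (cone f) q :=
  contDiffAt_fst.smul (hf.comp q contDiffAt_snd)

theorem fderiv_cone_apply {f : E → V} {q : ℝ × E} (hf : DifferentiableAt ℝ f q.2) (u : ℝ × E) :
    fderiv ℝ (cone f) q u = u.1 • f q.2 + q.1 • fderiv ℝ f q.2 u.2 := by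
  have h : HasFDerivAt (cone f) _ q :=
    (hasFDerivAt_fst (𝕜 := ℝ) (p := q)).smul (hf.hasFDerivAt.comp q hasFDerivAt_snd)
  rw [h.fderiv]
  simp [add_comm]

theorem inner_fderiv_eq_zero_of_norm_eq_one {f : E → V} {x : E} (hf : DifferentiableAt ℝ f x)
    (h1 : ∀ᶠ y in 𝓝 x, ‖f y‖ = 1) (v : E) : inner ℝ (f x) (fderiv ℝ f x v) = 0 := by
  have hc : (fun y => (inner ℝ (f y) (f y) : ℝ)) =ᶠ[𝓝 x] fun _ => 1 :=
    h1.mono fun y hy => by simp [hy]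
  have := congrArg (fun T : E →L[ℝ] ℝ => T v) hc.fderiv_eq
  rw [fderiv_inner_apply ℝ hf hf, real_inner_comm (f x)] at this
  simp at this
  linarith

theorem inner_fderiv_cone {f : E → V} {q : ℝ × E} (hf : DifferentiableAt ℝ f q.2)
    (h1 : ∀ᶠ y in 𝓝 q.2, ‖f y‖ = 1) (u v : ℝ × E) :
    inner ℝ (fderiv ℝ (cone f) q u) (fderiv ℝ (cone f) q v) =
      u.1 * v.1 + q.1 ^ 2 * inner ℝ (fderiv ℝ f q.2 u.2) (fderiv ℝ f q.2 v.2) := by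
  have z := inner_fderiv_eq_zero_of_norm_eq_one hf h1
  rw [fderiv_cone_apply hf, fderiv_cone_apply hf]
  simp only [inner_add_left, inner_add_right, real_inner_smul_left, real_inner_smul_right,
    real_inner_self_eq_norm_sq, h1.self_of_nhds, z, real_inner_comm (f q.2) (fderiv ℝ f q.2 _)]
  ring

variable [FiniteDimensional ℝ E] [FiniteDimensional ℝ V]

theorem isInvertible_fderiv_cone (hdim : Module.finrank ℝ V = Module.finrank ℝ E + 1)
    {f : E → V} {q : ℝ × E} (hq : q.1 ≠ 0) (hf : DifferentiableAt ℝ f q.2)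
    (h1 : ∀ᶠ y in 𝓝 q.2, ‖f y‖ = 1) (hinj : Function.Injective (fderiv ℝ f q.2)) :
    (fderiv ℝ (cone f) q).IsInvertible := by
  have hI : Function.Injective (fderiv ℝ (cone f) q) := by
    rw [injective_iff_map_eq_zero]
    intro u hu
    have h := inner_fderiv_cone hf h1 u u
    rw [hu, inner_zero_left, real_inner_self_eq_norm_sq] at h
    have hu1 : u.1 = 0 := by nlinarith [sq_nonneg (q.1 * ‖fderiv ℝ f q.2 u.2‖), sq_nonneg u.1]
    rw [fderiv_cone_apply hf, hu1, zero_smul, zero_add, smul_eq_zero] at hu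
    exact Prod.ext hu1 ((injective_iff_map_eq_zero _).1 hinj _ (hu.resolve_left hq))
  have hfr : Module.finrank ℝ (ℝ × E) = Module.finrank ℝ V := by
    rw [Module.finrank_prod, hdim, Module.finrank_self, add_comm]
  exact ⟨(LinearEquiv.ofInjectiveOfFinrankEq _ hI hfr).toContinuousLinearEquiv, by
    ext <;> rfl⟩

/-- The cone over an immersed hypersurface of the unit sphere is a local diffeomorphism along `t = 1`. -/
theorem map_cone_nhds (hdim : Module.finrank ℝ V = Module.finrank ℝ E + 1)
    {f : E → V} {x : E} (hf : ContDiffAt ℝ 2 f x)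
    (h1 : ∀ᶠ y in 𝓝 x, ‖f y‖ = 1) (hinj : Function.Injective (fderiv ℝ f x)) :
    map (cone f) (𝓝 (1, x)) = 𝓝 (f x) := by
  have hq : ContDiffAt ℝ 2 (cone f) (1, x) := contDiffAt_cone (q := (1, x)) hf
  have hi := isInvertible_fderiv_cone hdim (q := (1, x)) one_ne_zero
    (hf.differentiableAt two_ne_zero) h1 hinj
  have hs := (hq.hasStrictFDerivAt two_ne_zero).map_nhds_eq_of_surj
    (LinearMap.range_eq_top.2 hi.surjective)
  rwa [cone, one_smul] at hs

/-- An immersion into the unit sphere of the same dimension is open: on the sphere, a value of the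
cone near `f x` has radial parameter `t = 1` and so is a value of `f`. -/
theorem eventually_exists_mem_eq_of_norm_eq_one (hdim : Module.finrank ℝ V = Module.finrank ℝ E + 1)
    {f : E → V} {x : E} (hf : ContDiffAt ℝ 2 f x)
    (h1 : ∀ᶠ y in 𝓝 x, ‖f y‖ = 1) (hinj : Function.Injective (fderiv ℝ f x))
    {N : Set E} (hN : N ∈ 𝓝 x) :
    ∀ᶠ z in 𝓝 (f x), ‖z‖ = 1 → ∃ y ∈ N, f y = z := by
  rw [← map_cone_nhds hdim hf h1 hinj, eventually_map, nhds_prod_eq]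
  filter_upwards [prod_mem_prod (Ioi_mem_nhds (zero_lt_one' ℝ)) (inter_mem hN h1)]
  rintro ⟨t, y⟩ ⟨ht, hyN, hy⟩ hz
  have ht : 0 < t := ht
  have hy : ‖f y‖ = 1 := hy
  have ht1 : t = 1 := by
    rwa [cone, norm_smul, hy, mul_one, Real.norm_of_nonneg ht.le] at hz
  exact ⟨y, hyN, by simp [cone, ht1]⟩

/-- A linear map is determined by its values on a small open piece of the sphere, since by homogeneity
it is then known on the open cone over that piece. -/
theorem linearMap_eq_of_eventually_eq (hdim : Module.finrank ℝ V = Module.finrank ℝ E + 1)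
    {f : E → V} {x : E} (hf : ContDiffAt ℝ 2 f x)
    (h1 : ∀ᶠ y in 𝓝 x, ‖f y‖ = 1) (hinj : Function.Injective (fderiv ℝ f x))
    {A B : V →L[ℝ] V} (hAB : ∀ᶠ y in 𝓝 x, A (f y) = B (f y)) : A = B := by
  have h : ⇑A =ᶠ[𝓝 (f x)] ⇑B := by
    rw [EventuallyEq, ← map_cone_nhds hdim hf h1 hinj, eventually_map, nhds_prod_eq]
    filter_upwards [hAB.prod_inr (𝓝 1)] with q hq
    simp only [cone, map_smul, hq]
  simpa using h.fderiv_eq (𝕜 := ℝ)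

/-- Local rigidity: two immersions into the unit sphere of the same dimension that induce the same
metric differ locally by a linear isometry. Their cones induce the same metric
`dt² + t² g`, so the linear isometry carrying one differential to the other is constant. -/
theorem exists_linearIsometryEquiv_eventually_eq
    (hdim : Module.finrank ℝ V = Module.finrank ℝ E + 1) {f h : E → V} {x : E}
    (hf : ∀ᶠ y in 𝓝 x, ContDiffAt ℝ 2 f y) (hh : ∀ᶠ y in 𝓝 x, ContDiffAt ℝ 2 h y)
    (hf1 : ∀ᶠ y in 𝓝 x, ‖f y‖ = 1) (hh1 : ∀ᶠ y in 𝓝 x, ‖h y‖ = 1)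
    (hinj : ∀ᶠ y in 𝓝 x, Function.Injective (fderiv ℝ f y))
    (hmet : ∀ᶠ y in 𝓝 x, ∀ u v, inner ℝ (fderiv ℝ f y u) (fderiv ℝ f y v) =
      inner ℝ (fderiv ℝ h y u) (fderiv ℝ h y v)) :
    ∃ A : V ≃ₗᵢ[ℝ] V, ∀ᶠ y in 𝓝 x, A (f y) = h y := by
  obtain ⟨r, hr, hball⟩ := Metric.eventually_nhds_iff_ball.1
    (hf.and (hh.and (hf1.eventually_nhds.and (hh1.eventually_nhds.and (hinj.and hmet)))))
  set Ω : Set (ℝ × E) := Set.Ioi 0 ×ˢ Metric.ball x r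
  have hΩ : IsOpen Ω := isOpen_Ioi.prod Metric.isOpen_ball
  have hΩc : IsPreconnected Ω := ((convex_Ioi 0).prod (convex_ball x r)).isPreconnected
  have met : ∀ q ∈ Ω, ∀ u v,
      inner ℝ (fderiv ℝ (cone f) q u) (fderiv ℝ (cone f) q v) =
        inner ℝ (fderiv ℝ (cone h) q u) (fderiv ℝ (cone h) q v) := by
    rintro q ⟨-, hq⟩ u v
    obtain ⟨c1, c2, n1, n2, -, m⟩ := hball _ hq
    rw [inner_fderiv_cone (c1.differentiableAt two_ne_zero) n1,
      inner_fderiv_cone (c2.differentiableAt two_ne_zero) n2, m]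
  have invf : ∀ q ∈ Ω, (fderiv ℝ (cone f) q).IsInvertible := by
    rintro q ⟨hq0, hq⟩
    obtain ⟨c1, -, n1, -, i, -⟩ := hball _ hq
    exact isInvertible_fderiv_cone hdim (ne_of_gt hq0) (c1.differentiableAt two_ne_zero) n1 i
  have invh : ∀ q ∈ Ω, (fderiv ℝ (cone h) q).IsInvertible := by
    rintro q ⟨hq0, hq⟩
    obtain ⟨-, c2, -, n2, i, m⟩ := hball _ hq
    refine isInvertible_fderiv_cone hdim (ne_of_gt hq0) (c2.differentiableAt two_ne_zero) n2 ?_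
    rw [injective_iff_map_eq_zero] at i ⊢
    intro v hv
    apply i
    rw [← inner_self_eq_zero (𝕜 := ℝ), m, hv, inner_zero_left]
  set T : ℝ × E → V →L[ℝ] V := fun q =>
    (fderiv ℝ (cone h) q).comp (fderiv ℝ (cone f) q).inverse with hT
  have dT : ∀ q ∈ Ω, HasFDerivAt (𝕜 := ℝ) T (0 : ℝ × E →L[ℝ] V →L[ℝ] V) q := by
    intro q hq
    obtain ⟨c1, c2, -⟩ := hball _ hq.2
    have hΩq := hΩ.mem_nhds hq
    exact hasFDerivAt_transition_zero (contDiffAt_cone c1) (contDiffAt_cone c2)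
      (mem_of_superset hΩq met) (mem_of_superset hΩq invf) (invh q hq).surjective
  have hTc : ∀ q ∈ Ω, ∀ q' ∈ Ω, T q = T q' := fun q hq q' hq' =>
    hΩ.is_const_of_fderiv_eq_zero hΩc (𝕜 := ℝ)
      (fun p hp => (dT p hp).differentiableAt.differentiableWithinAt)
      (fun p hp => (dT p hp).fderiv) hq hq'
  have hTap : ∀ q ∈ Ω, ∀ u, T q (fderiv ℝ (cone f) q u) = fderiv ℝ (cone h) q u := by
    intro q hq u
    simp [hT, (invf q hq).inverse_apply_self]
  have hmem : ∀ y ∈ Metric.ball x r, ((1 : ℝ), y) ∈ Ω := fun y hy => ⟨zero_lt_one' ℝ, hy⟩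
  have hx := hmem x (Metric.mem_ball_self hr)
  have hiso : ∀ a b, inner ℝ (T (1, x) a) (T (1, x) b) = (inner ℝ a b : ℝ) := by
    intro a b
    obtain ⟨a, rfl⟩ := (invf _ hx).surjective a
    obtain ⟨b, rfl⟩ := (invf _ hx).surjective b
    rw [hTap _ hx, hTap _ hx, met _ hx]
  refine ⟨((T (1, x)).toLinearMap.isometryOfInner hiso).toLinearIsometryEquiv rfl,
    Metric.eventually_nhds_iff_ball.2 ⟨r, hr, fun y hy => ?_⟩⟩
  obtain ⟨c1, c2, -⟩ := hball _ hy
  have h0 := hTap _ (hmem y hy) (1, 0)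
  rw [fderiv_cone_apply (c1.differentiableAt two_ne_zero),
    fderiv_cone_apply (c2.differentiableAt two_ne_zero), hTc _ (hmem y hy) _ hx] at h0
  simpa using h0

end Cone

/-! ### Rigidity on manifolds -/

section Hypersurface

variable {n : ℕ} {M : Type*} [TopologicalSpace M] [ChartedSpace (EuclideanSpace ℝ (Fin n)) M]
  {V : Type*} [NormedAddCommGroup V] [InnerProductSpace ℝ V]

theorem extChartAt_target_mem_nhds_of_mem {p : M} {y : EuclideanSpace ℝ (Fin n)}
    (hy : y ∈ (extChartAt (𝓡 n) p).target) : (extChartAt (𝓡 n) p).target ∈ 𝓝 y :=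
  (isOpen_extChartAt_target p).mem_nhds hy

theorem eventually_nhds_iff_extChartAt {p : M} {P : M → Prop} :
    (∀ᶠ y in 𝓝 (extChartAt (𝓡 n) p p), P ((extChartAt (𝓡 n) p).symm y)) ↔ ∀ᶠ q in 𝓝 p, P q := by
  conv_rhs => rw [← map_extChartAt_symm_nhdsWithin_range (I := 𝓡 n) p, (𝓡 n).range_eq_univ,
    nhdsWithin_univ]
  rfl

variable [IsManifold (𝓡 n) ∞ M]

theorem contDiffAt_comp_extChartAt_symm {F : M → V} (hF : ContMDiff (𝓡 n) 𝓘(ℝ, V) ∞ F) {p : M}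
    {y : EuclideanSpace ℝ (Fin n)} (hy : y ∈ (extChartAt (𝓡 n) p).target) :
    ContDiffAt ℝ 2 (F ∘ (extChartAt (𝓡 n) p).symm) y := by
  have h := (hF.comp_contMDiffOn (contMDiffOn_extChartAt_symm (n := ∞) p)).contDiffOn
  exact (h.contDiffAt (extChartAt_target_mem_nhds_of_mem hy)).of_le 
    (show ((2 : ℕ∞) : ℕ∞ω) ≤ ∞ from mod_cast le_top)

theorem fderiv_comp_extChartAt_symm {F : M → V} (hF : ContMDiff (𝓡 n) 𝓘(ℝ, V) ∞ F) {p : M}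
    {y : EuclideanSpace ℝ (Fin n)} (hy : y ∈ (extChartAt (𝓡 n) p).target)
    (u : EuclideanSpace ℝ (Fin n)) :
    fderiv ℝ (F ∘ (extChartAt (𝓡 n) p).symm) y u =
      mvfderiv (𝓡 n) F ((extChartAt (𝓡 n) p).symm y)
        (mfderiv 𝓘(ℝ, EuclideanSpace ℝ (Fin n)) (𝓡 n) (extChartAt (𝓡 n) p).symm y u) := by
  have hs : MDifferentiableAt 𝓘(ℝ, EuclideanSpace ℝ (Fin n)) (𝓡 n)
      (extChartAt (𝓡 n) p).symm y :=
    ((contMDiffOn_extChartAt_symm (n := ∞) p).contMDiffAt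
      (extChartAt_target_mem_nhds_of_mem hy)).mdifferentiableAt (by simp)
  have h := mfderiv_comp_apply (I'' := 𝓘(ℝ, V)) y
    ((hF ((extChartAt (𝓡 n) p).symm y)).mdifferentiableAt (by simp)) hs u
  rw [mfderiv_eq_fderiv] at h
  exact h

theorem injective_mfderiv_extChartAt_symm {p : M}
    {y : EuclideanSpace ℝ (Fin n)} (hy : y ∈ (extChartAt (𝓡 n) p).target) :
    Function.Injective
      (mfderiv 𝓘(ℝ, EuclideanSpace ℝ (Fin n)) (𝓡 n) (extChartAt (𝓡 n) p).symm y) := by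
  have h := (isInvertible_mfderivWithin_extChartAt_symm (I := 𝓡 n) hy).injective
  rw [(𝓡 n).range_eq_univ, mfderivWithin_univ] at h
  exact h

theorem injective_fderiv_comp_extChartAt_symm {F : M → V} (hF : ContMDiff (𝓡 n) 𝓘(ℝ, V) ∞ F)
    (hinj : ∀ p, Function.Injective (mvfderiv (𝓡 n) F p)) {p : M}
    {y : EuclideanSpace ℝ (Fin n)} (hy : y ∈ (extChartAt (𝓡 n) p).target) :
    Function.Injective (fderiv ℝ (F ∘ (extChartAt (𝓡 n) p).symm) y) := by
  intro u v huv
  rw [fderiv_comp_extChartAt_symm hF hy, fderiv_comp_extChartAt_symm hF hy] at huv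
  exact injective_mfderiv_extChartAt_symm hy (hinj _ huv)

variable [FiniteDimensional ℝ V]

theorem eventually_mem_range_of_norm_eq_one (hdim : Module.finrank ℝ V = n + 1) {F : M → V}
    (hF : ContMDiff (𝓡 n) 𝓘(ℝ, V) ∞ F) (hF1 : ∀ p, ‖F p‖ = 1)
    (hinj : ∀ p, Function.Injective (mvfderiv (𝓡 n) F p)) (p : M) :
    ∀ᶠ z in 𝓝 (F p), ‖z‖ = 1 → z ∈ Set.range F := by
  have hy := mem_extChartAt_target (I := 𝓡 n) p
  have h := eventually_exists_mem_eq_of_norm_eq_one (by simpa using hdim)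
    (contDiffAt_comp_extChartAt_symm hF hy) (.of_forall fun _ => hF1 _)
    (injective_fderiv_comp_extChartAt_symm hF hinj hy) univ_mem
  rw [Function.comp_apply, extChartAt_to_inv] at h
  refine h.mono fun z hz hz1 => ?_
  obtain ⟨y, -, rfl⟩ := hz hz1
  exact ⟨_, rfl⟩

theorem linearIsometryEquiv_eq_of_eventually_eq (hdim : Module.finrank ℝ V = n + 1) {F : M → V}
    (hF : ContMDiff (𝓡 n) 𝓘(ℝ, V) ∞ F) (hF1 : ∀ p, ‖F p‖ = 1)
    (hinj : ∀ p, Function.Injective (mvfderiv (𝓡 n) F p)) {p : M} {A B : V ≃ₗᵢ[ℝ] V}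
    (hAB : ∀ᶠ q in 𝓝 p, A (F q) = B (F q)) : A = B := by
  have hy := mem_extChartAt_target (I := 𝓡 n) p
  have h := linearMap_eq_of_eventually_eq (by simpa using hdim)
    (contDiffAt_comp_extChartAt_symm hF hy) (.of_forall fun _ => hF1 _)
    (injective_fderiv_comp_extChartAt_symm hF hinj hy)
    (A := (A.toContinuousLinearEquiv : V →L[ℝ] V)) (B := (B.toContinuousLinearEquiv : V →L[ℝ] V))
    (eventually_nhds_iff_extChartAt.2 hAB)
  ext v
  exact congrArg (fun T : V →L[ℝ] V => T v) h

/-- Rigidity of local isometries of the sphere: on a connected manifold, two immersions into the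
unit sphere of the same dimension with the same induced metric differ by one linear isometry. -/
theorem exists_linearIsometryEquiv_eq [ConnectedSpace M] (hdim : Module.finrank ℝ V = n + 1)
    {F G : M → V} (hF : ContMDiff (𝓡 n) 𝓘(ℝ, V) ∞ F) (hG : ContMDiff (𝓡 n) 𝓘(ℝ, V) ∞ G)
    (hF1 : ∀ p, ‖F p‖ = 1) (hG1 : ∀ p, ‖G p‖ = 1)
    (hinj : ∀ p, Function.Injective (mvfderiv (𝓡 n) F p))
    (hmet : ∀ p v w, inner ℝ (mvfderiv (𝓡 n) F p v) (mvfderiv (𝓡 n) F p w) =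
      inner ℝ (mvfderiv (𝓡 n) G p v) (mvfderiv (𝓡 n) G p w)) :
    ∃ A : V ≃ₗᵢ[ℝ] V, ∀ p, A (F p) = G p := by
  have hloc : ∀ p : M, ∃ A : V ≃ₗᵢ[ℝ] V, ∀ᶠ q in 𝓝 p, A (F q) = G q := by
    intro p
    have ht := extChartAt_target_mem_nhds_of_mem (mem_extChartAt_target (I := 𝓡 n) p)
    obtain ⟨A, hA⟩ := exists_linearIsometryEquiv_eventually_eq (by simpa using hdim)
      (mem_of_superset ht fun y hy => contDiffAt_comp_extChartAt_symm hF hy)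
      (mem_of_superset ht fun y hy => contDiffAt_comp_extChartAt_symm hG hy)
      (.of_forall fun _ => hF1 _) (.of_forall fun _ => hG1 _)
      (mem_of_superset ht fun y hy => injective_fderiv_comp_extChartAt_symm hF hinj hy)
      (mem_of_superset ht fun y hy u v => by
        simp only [fderiv_comp_extChartAt_symm hF hy, fderiv_comp_extChartAt_symm hG hy, hmet])
    exact ⟨A, eventually_nhds_iff_extChartAt.1 hA⟩
  choose A hA using hloc
  have hconst : IsLocallyConstant A := by
    rw [IsLocallyConstant.iff_eventually_eq]
    intro p
    filter_upwards [(hA p).eventually_nhds] with q hq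
    exact linearIsometryEquiv_eq_of_eventually_eq hdim hF hF1 hinj
      ((hA q).and hq |>.mono fun z hz => hz.1.trans hz.2.symm)
  obtain ⟨p⟩ := (inferInstance : Nonempty M)
  exact ⟨A p, fun q => by
    rw [hconst.apply_eq_of_preconnectedSpace p q, (hA q).self_of_nhds]⟩

end Hypersurface

/-! ### The Jacobian of a Lagrangian immersion -/

section Lagrangian

/-- The square of the area form is the Gram determinant of the two tangent vectors. -/
theorem areaForm_sq (x : S2) {v w : R3} (hv : inner ℝ (x : R3) v = 0)
    (hw : inner ℝ (x : R3) w = 0) :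
    areaForm x v w ^ 2 = inner ℝ v v * inner ℝ w w - inner ℝ v w ^ 2 := by
  have hx : inner ℝ (x : R3) (x : R3) = 1 := by simp
  have gram : areaForm x v w ^ 2 =
      inner ℝ (x : R3) (x : R3) * (inner ℝ v v * inner ℝ w w - inner ℝ v w ^ 2)
        - inner ℝ (x : R3) v * (inner ℝ (x : R3) v * inner ℝ w w
          - 2 * (inner ℝ v w * inner ℝ (x : R3) w))
        - inner ℝ (x : R3) w ^ 2 * inner ℝ v v := by
    simp only [areaForm, cross3, PiLp.inner_apply, Fin.sum_univ_three, cross_apply]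
    simp
    ring
  rw [gram, hx, hv, hw]
  ring

theorem areaForm_neg (x : S2) (v w : R3) : areaForm (-x) (-v) (-w) = -areaForm x v w := by
  simp only [areaForm, cross3, PiLp.inner_apply, Fin.sum_univ_three, cross_apply]
  simp
  ring

theorem inner_mvfderiv_coe (x : S2) (v : TangentSpace (𝓡 2) x) :
    inner ℝ (x : R3) (mvfderiv (𝓡 2) (fun y : S2 => (y : R3)) x v) = 0 := by
  have : Fact (Module.finrank ℝ R3 = 2 + 1) := ⟨finrank_euclideanSpace_fin⟩
  have h := range_mvfderiv_subtypeVal (n := 2) x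
  have hm : mvfderiv (𝓡 2) (fun y : S2 => (y : R3)) x v ∈ (ℝ ∙ (x : R3))ᗮ :=
    h ▸ LinearMap.mem_range_self _ v
  exact Submodule.mem_orthogonal_singleton_iff_inner_right.1 hm

variable {M : Type*} [TopologicalSpace M] [ChartedSpace (EuclideanSpace ℝ (Fin 2)) M]

theorem contMDiff_coe_fst {Φ : M → S2 × S2} (hΦ : IsSmoothImmersion Φ) :
    ContMDiff (𝓡 2) 𝓘(ℝ, R3) ∞ (fun q => ((Φ q).1 : R3)) :=
  haveI : Fact (Module.finrank ℝ R3 = 2 + 1) := ⟨finrank_euclideanSpace_fin⟩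
  contMDiff_coe_sphere.comp (contMDiff_fst.comp hΦ.1)

theorem contMDiff_coe_snd {Φ : M → S2 × S2} (hΦ : IsSmoothImmersion Φ) :
    ContMDiff (𝓡 2) 𝓘(ℝ, R3) ∞ (fun q => ((Φ q).2 : R3)) :=
  haveI : Fact (Module.finrank ℝ R3 = 2 + 1) := ⟨finrank_euclideanSpace_fin⟩
  contMDiff_coe_sphere.comp (contMDiff_snd.comp hΦ.1)

theorem inner_dFst {Φ : M → S2 × S2} (hΦ : IsSmoothImmersion Φ) (p : M)
    (v : TangentSpace (𝓡 2) p) : inner ℝ ((Φ p).1 : R3) (dFst Φ p v) = 0 := by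
  have h := (contMDiff_fst.comp hΦ.1 p).mdifferentiableAt (n := ∞) (by simp)
  rw [dFst, mvfderiv_coe_comp (fun q => (Φ q).1) p h v]
  exact inner_mvfderiv_coe _ _

theorem inner_dSnd {Φ : M → S2 × S2} (hΦ : IsSmoothImmersion Φ) (p : M)
    (v : TangentSpace (𝓡 2) p) : inner ℝ ((Φ p).2 : R3) (dSnd Φ p v) = 0 := by
  have h := (contMDiff_snd.comp hΦ.1 p).mdifferentiableAt (n := ∞) (by simp)
  rw [dSnd, mvfderiv_coe_comp (fun q => (Φ q).2) p h v]
  exact inner_mvfderiv_coe _ _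

theorem jacobianSq_eq_fst {Φ : M → S2 × S2} (hΦ : IsSmoothImmersion Φ) {p : M}
    {e : Fin 2 → TangentSpace (𝓡 2) p} (he : IsOrthonormalFrame Φ p e) :
    jacobianSq Φ p = inner ℝ (dFst Φ p (e 0)) (dFst Φ p (e 0)) *
      inner ℝ (dFst Φ p (e 1)) (dFst Φ p (e 1)) -
        inner ℝ (dFst Φ p (e 0)) (dFst Φ p (e 1)) ^ 2 := by
  rw [jacobianSq_eq Φ p e he, areaForm_sq _ (inner_dFst hΦ p _) (inner_dFst hΦ p _)]

theorem jacobianSq_eq_snd {Φ : M → S2 × S2} (hΦ : IsLagrangianImmersion Φ) {p : M}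
    {e : Fin 2 → TangentSpace (𝓡 2) p} (he : IsOrthonormalFrame Φ p e) :
    jacobianSq Φ p = inner ℝ (dSnd Φ p (e 0)) (dSnd Φ p (e 0)) *
      inner ℝ (dSnd Φ p (e 1)) (dSnd Φ p (e 1)) -
        inner ℝ (dSnd Φ p (e 0)) (dSnd Φ p (e 1)) ^ 2 := by
  rw [jacobianSq_eq Φ p e he, ← areaForm_sq _ (inner_dSnd hΦ.1 p _) (inner_dSnd hΦ.1 p _),
    eq_neg_of_add_eq_zero_left (hΦ.2 p (e 0) (e 1)), neg_sq]

/-- Both projections have Jacobian `± C`, and the Gram matrices of their differentials in an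
orthonormal frame add up to the identity. Equating the two Gram determinants gives trace one for
the first, so that `C²` falls short of `1 / 4` by a sum of squares. -/
theorem jacobianSq_eq_quarter_sub {Φ : M → S2 × S2} (hΦ : IsLagrangianImmersion Φ) {p : M}
    {e : Fin 2 → TangentSpace (𝓡 2) p} (he : IsOrthonormalFrame Φ p e) :
    inner ℝ (dFst Φ p (e 0)) (dFst Φ p (e 0)) + inner ℝ (dFst Φ p (e 1)) (dFst Φ p (e 1)) =
      (1 : ℝ) ∧
    jacobianSq Φ p = 1 / 4 - (inner ℝ (dFst Φ p (e 0)) (dFst Φ p (e 0)) - 1 / 2) ^ 2 -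
        inner ℝ (dFst Φ p (e 0)) (dFst Φ p (e 1)) ^ 2 := by
  have h1 := jacobianSq_eq_fst hΦ.1 he
  have h2 := jacobianSq_eq_snd hΦ he
  have e00 := he 0 0
  have e01 := he 0 1
  have e11 := he 1 1
  simp only [inducedMetric, if_true, zero_ne_one, if_false] at e00 e01 e11
  rw [← eq_sub_iff_add_eq'] at e00 e01 e11
  rw [e00, e01, e11] at h2
  have hs : inner ℝ (dFst Φ p (e 0)) (dFst Φ p (e 0)) +
      inner ℝ (dFst Φ p (e 1)) (dFst Φ p (e 1)) = (1 : ℝ) := by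
    linear_combination h2 - h1
  exact ⟨hs, by
    linear_combination h1 + inner ℝ (dFst Φ p (e 0)) (dFst Φ p (e 0)) * hs⟩

theorem IsOrthonormalFrame.exists_eq_smul_add_smul {Φ : M → S2 × S2} {p : M}
    {e : Fin 2 → TangentSpace (𝓡 2) p} (he : IsOrthonormalFrame Φ p e)
    (v : TangentSpace (𝓡 2) p) : ∃ a b : ℝ, v = a • e 0 + b • e 1 := by
  have hli : LinearIndependent ℝ e := by
    rw [Fintype.linearIndependent_iff]
    intro c hc
    have h : ∀ i, inducedMetric Φ p (c 0 • e 0 + c 1 • e 1) (e i) = 0 := fun i => by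
      rw [Fin.sum_univ_two] at hc
      simp [hc, inducedMetric]
    simp only [inducedMetric_add_smul, he _ _] at h
    have h0 := h 0
    have h1 := h 1
    simp only [if_true, zero_ne_one, one_ne_zero, if_false, mul_one, mul_zero, add_zero,
      zero_add] at h0 h1
    rw [Fin.forall_fin_two]
    exact ⟨h0, h1⟩
  have hfr : Module.finrank ℝ (TangentSpace (𝓡 2) p) = 2 :=
    finrank_euclideanSpace_fin (𝕜 := ℝ) (n := 2)
  let B := basisOfLinearIndependentOfCardEqFinrank hli (by simp [hfr])
  exact ⟨B.repr v 0, B.repr v 1, by simpa [B, Fin.sum_univ_two] using (B.sum_repr v).symm⟩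

/-- The extremal case `C² = 1 / 4` is the one where both projections induce the same metric, which is
then half of the metric of the surface. -/
theorem jacobianSq_eq_quarter_iff {Φ : M → S2 × S2} (hΦ : IsLagrangianImmersion Φ) (p : M) :
    jacobianSq Φ p = 1 / 4 ↔ ∀ v w : TangentSpace (𝓡 2) p,
      inner ℝ (dFst Φ p v) (dFst Φ p w) = (inner ℝ (dSnd Φ p v) (dSnd Φ p w) : ℝ) := by
  obtain ⟨e, he⟩ := exists_isOrthonormalFrame Φ hΦ.1 p
  obtain ⟨hs, hJ⟩ := jacobianSq_eq_quarter_sub hΦ he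
  have e00 := he 0 0
  have e01 := he 0 1
  have e11 := he 1 1
  simp only [inducedMetric, if_true, zero_ne_one, if_false] at e00 e01 e11
  constructor
  · intro h v w
    rw [h] at hJ
    have h01 : inner ℝ (dFst Φ p (e 0)) (dFst Φ p (e 1)) = (0 : ℝ) := by
      rw [← sq_eq_zero_iff]
      nlinarith [sq_nonneg (inner ℝ (dFst Φ p (e 0)) (dFst Φ p (e 0)) - 1 / 2 : ℝ),
        sq_nonneg (inner ℝ (dFst Φ p (e 0)) (dFst Φ p (e 1)) : ℝ)]
    have h00 : inner ℝ (dFst Φ p (e 0)) (dFst Φ p (e 0)) - 1 / 2 = (0 : ℝ) := by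
      rw [← sq_eq_zero_iff]
      rw [h01] at hJ
      linarith
    have k00 : inner ℝ (dSnd Φ p (e 0)) (dSnd Φ p (e 0)) = (1 / 2 : ℝ) := by linarith
    have k01 : inner ℝ (dSnd Φ p (e 0)) (dSnd Φ p (e 1)) = (0 : ℝ) := by linarith
    have k11 : inner ℝ (dSnd Φ p (e 1)) (dSnd Φ p (e 1)) = (1 / 2 : ℝ) := by linarith
    have h11 : inner ℝ (dFst Φ p (e 1)) (dFst Φ p (e 1)) = (1 / 2 : ℝ) := by linarith
    rw [sub_eq_zero] at h00
    obtain ⟨a, b, rfl⟩ := he.exists_eq_smul_add_smul v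
    obtain ⟨c, d, rfl⟩ := he.exists_eq_smul_add_smul w
    simp only [map_add, map_smul, inner_add_left, inner_add_right, real_inner_smul_left,
      real_inner_smul_right, real_inner_comm (dFst Φ p (e 0)) (dFst Φ p (e 1)),
      real_inner_comm (dSnd Φ p (e 0)) (dSnd Φ p (e 1)), h00, h01, h11, k00, k01, k11]
  · intro h
    rw [← h] at e00 e01
    have h00 : inner ℝ (dFst Φ p (e 0)) (dFst Φ p (e 0)) = (1 / 2 : ℝ) := by linarith
    have h01 : inner ℝ (dFst Φ p (e 0)) (dFst Φ p (e 1)) = (0 : ℝ) := by linarith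
    rw [hJ, h00, h01]
    norm_num

theorem mvfderiv_linearIsometryEquiv_comp (A : R3 ≃ₗᵢ[ℝ] R3) {F : M → R3} {p : M}
    (hF : MDifferentiableAt (𝓡 2) 𝓘(ℝ, R3) F p) (v : TangentSpace (𝓡 2) p) :
    mvfderiv (𝓡 2) (fun q => A (F q)) p v = A (mvfderiv (𝓡 2) F p v) := by
  have hA := A.toContinuousLinearEquiv.hasFDerivAt (x := F p)
  have h := (hA.hasMFDerivAt.comp p hF.hasMFDerivAt).mfderiv
  rw [mvfderiv]
  exact congrArg (fun T => T v) h

theorem injective_dFst_of_jacobianSq_eq {Φ : M → S2 × S2} (hΦ : IsLagrangianImmersion Φ) {p : M}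
    (hp : jacobianSq Φ p = 1 / 4) : Function.Injective (dFst Φ p) := by
  rw [injective_iff_map_eq_zero]
  intro v hv
  by_contra hv0
  have h := inducedMetric_pos Φ hΦ.1 p v hv0
  rw [inducedMetric, ← (jacobianSq_eq_quarter_iff hΦ p).1 hp, hv, inner_zero_left] at h
  simp at h

theorem isLagrangianImmersion_antidiagonal : IsLagrangianImmersion (fun x : S2 => (x, -x)) := by
  have : Fact (Module.finrank ℝ R3 = 2 + 1) := ⟨finrank_euclideanSpace_fin⟩
  have hsm : ContMDiff (𝓡 2) ((𝓡 2).prod (𝓡 2)) ∞ (fun x : S2 => (x, -x)) :=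
    contMDiff_id.prodMk contMDiff_neg_sphere
  refine ⟨⟨hsm, fun p => ?_⟩, fun p v w => ?_⟩
  · have hd := (hsm p).mdifferentiableAt (by simp)
    have hc := mfderiv_comp (I := 𝓡 2) (I' := (𝓡 2).prod (𝓡 2)) (I'' := 𝓡 2) p
      (g := Prod.fst) mdifferentiableAt_fst hd
    have hid : (Prod.fst ∘ fun x : S2 => (x, -x)) = id := rfl
    rw [hid, mfderiv_id] at hc
    intro u v huv
    have h := congrArg (fun T => T u) hc
    have h' := congrArg (fun T => T v) hc
    simp only [ContinuousLinearMap.comp_apply, huv] at h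
    exact h.trans h'.symm
  · have h : ∀ u, dSnd (fun x : S2 => (x, -x)) p u = -dFst (fun x : S2 => (x, -x)) p u := fun u =>
      mvfderiv_linearIsometryEquiv_comp (LinearIsometryEquiv.neg ℝ) (mdifferentiableAt_coe p) u
    rw [h, h, areaForm_neg, add_neg_cancel]

end Lagrangian

/-! ### Congruence with a part of the antidiagonal -/

section Congruence

/-- Surfaces congruent to a part of the antidiagonal are contained in graphs of linear isometries, for
isometries of both kinds: `(A x, -B x)` and `(-A x, B x)` lie on the graph of `-B A⁻¹`. -/
theorem exists_linearIsometryEquiv_of_areCongruent {M : Type*} {Φ : M → S2 × S2}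
    {V : Set (S2 × S2)} (hV : IsOpenSubsetOfAntidiagonal V) (hc : AreCongruent (Set.range Φ) V) :
    ∃ C : R3 ≃ₗᵢ[ℝ] R3, ∀ p, ((Φ p).2 : R3) = C (Φ p).1 := by
  obtain ⟨U, -, rfl⟩ := hV
  obtain ⟨T, ⟨A, B, hT⟩, hr⟩ := hc
  refine ⟨(A.symm.trans B).trans (LinearIsometryEquiv.neg ℝ), fun p => ?_⟩
  obtain ⟨q, ⟨-, x, rfl⟩, hq⟩ : Φ p ∈ T '' (U ∩ antidiagonal) := hr ▸ Set.mem_range_self p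
  rw [← hq]
  rcases hT with hT | hT <;> simp [hT]

/-- A graph `{(x, A x)}` over an open set is the image of a part of the antidiagonal under
`(x, y) ↦ (x, -A y)`. -/
theorem exists_areCongruent_of_linearIsometryEquiv {M : Type*} {Φ : M → S2 × S2}
    (hopen : IsOpen (Set.range fun p => (Φ p).1)) (A : R3 ≃ₗᵢ[ℝ] R3)
    (hA : ∀ p, A (Φ p).1 = (Φ p).2) :
    ∃ V : Set (S2 × S2), IsOpenSubsetOfAntidiagonal V ∧ AreCongruent (Set.range Φ) V := by
  let T : S2 × S2 → S2 × S2 := fun q => (q.1, ⟨-A q.2, by simp⟩)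
  have hT : ∀ p, T ((Φ p).1, -(Φ p).1) = Φ p := fun p =>
    Prod.ext rfl (Subtype.ext (by simp [T, hA]))
  refine ⟨_, ⟨_, hopen.preimage continuous_fst, rfl⟩, T,
    ⟨.refl ℝ R3, A.trans (LinearIsometryEquiv.neg ℝ), .inl fun q => ⟨rfl, rfl⟩⟩, ?_⟩
  ext z
  constructor
  · rintro ⟨p, rfl⟩
    exact ⟨((Φ p).1, -(Φ p).1), ⟨⟨p, rfl⟩, _, rfl⟩, hT p⟩
  · rintro ⟨q, ⟨⟨p, hp⟩, x, rfl⟩, rfl⟩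
    obtain rfl : (Φ p).1 = x := hp
    exact ⟨p, (hT p).symm⟩

theorem isOpen_range_of_injective_mvfderiv {M : Type*} [TopologicalSpace M]
    [ChartedSpace (EuclideanSpace ℝ (Fin 2)) M] [IsManifold (𝓡 2) ∞ M] {φ : M → S2}
    (hφ : ContMDiff (𝓡 2) 𝓘(ℝ, R3) ∞ (fun p => (φ p : R3)))
    (hinj : ∀ p, Function.Injective (mvfderiv (𝓡 2) (fun q => (φ q : R3)) p)) :
    IsOpen (Set.range φ) := by
  rw [isOpen_iff_mem_nhds]
  rintro _ ⟨p, rfl⟩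
  have h := eventually_mem_range_of_norm_eq_one finrank_euclideanSpace_fin hφ (by simp) hinj p
  filter_upwards [continuous_subtype_val.continuousAt.eventually h] with y hy
  obtain ⟨q, hq⟩ := hy (by simp)
  exact ⟨q, Subtype.ext hq⟩

end Congruence

theorem proposition2 {M : Type*} [TopologicalSpace M]
    [ChartedSpace (EuclideanSpace ℝ (Fin 2)) M] [IsManifold (𝓡 2) ∞ M]
    (Φ : M → S2 × S2) (hΦ : IsLagrangianImmersion Φ) :
    (∀ p : M, jacobianSq Φ p ≤ 1 / 4) ∧
    ((∃ V : Set (S2 × S2), IsOpenSubsetOfAntidiagonal V ∧ AreCongruent (Set.range Φ) V) →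
      ∀ p : M, jacobianSq Φ p = 1 / 4) ∧
    (ConnectedSpace M → (∀ p : M, jacobianSq Φ p = 1 / 4) →
      ∃ V : Set (S2 × S2), IsOpenSubsetOfAntidiagonal V ∧ AreCongruent (Set.range Φ) V) ∧
    IsLagrangianImmersion (fun x : S2 => (x, -x)) := by
  refine ⟨fun p => ?_, ?_, fun hM hJ => ?_, isLagrangianImmersion_antidiagonal⟩
  · obtain ⟨e, he⟩ := exists_isOrthonormalFrame Φ hΦ.1 p
    rw [(jacobianSq_eq_quarter_sub hΦ he).2]
    nlinarith [sq_nonneg (inner ℝ (dFst Φ p (e 0)) (dFst Φ p (e 0)) - 1 / 2 : ℝ),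
      sq_nonneg (inner ℝ (dFst Φ p (e 0)) (dFst Φ p (e 1)) : ℝ)]
  · rintro ⟨V, hV, hc⟩ p
    obtain ⟨C, hC⟩ := exists_linearIsometryEquiv_of_areCongruent hV hc
    have hd : ∀ v, dSnd Φ p v = C (dFst Φ p v) := by
      intro v
      rw [dSnd, funext hC]
      exact mvfderiv_linearIsometryEquiv_comp C
        ((contMDiff_coe_fst hΦ.1 p).mdifferentiableAt (by simp)) v
    rw [jacobianSq_eq_quarter_iff hΦ]
    intro v w
    rw [hd, hd, C.inner_map_map]
  · have hinj := fun p => injective_dFst_of_jacobianSq_eq hΦ (hJ p)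
    obtain ⟨A, hA⟩ := exists_linearIsometryEquiv_eq finrank_euclideanSpace_fin
      (contMDiff_coe_fst hΦ.1) (contMDiff_coe_snd hΦ.1) (by simp) (by simp) hinj
      fun p => (jacobianSq_eq_quarter_iff hΦ p).1 (hJ p)
    exact exists_areCongruent_of_linearIsometryEquiv
      (isOpen_range_of_injective_mvfderiv (contMDiff_coe_fst hΦ.1) hinj) A hA
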